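/- Let $X\neq\{0\}$ be a real or complex Banach space, let $\Omega$ be a nonempty compact Hausdorff space, and let $C(\Omega,X)$ be the Banach space of continuous functions $f:\Omega\to X$ with the supremum norm. For a Banach space $E$, write $E_1^*$ for the closed unit ball of $E^*$, and call $\varphi\in E_1^*$ a $w^*$-$w$ point of continuity if the identity map $(E_1^*,w^*)\to(E_1^*,w)$, where $w$ is the weak topology of the Banach space $E^*$, is continuous at $\varphi$. For $\omega\in\Omega$ and $x^*\in X^*$ let $\delta_\omega\otimes x^*\in C(\Omega,X)^*$ be the functional $f\mapsto x^*(f(\omega))$. Let $\Lambda\in C(\Omega,X)_1^*$ be a $w^*$-$w$ point of continuity. Then there are a finite or countably infinite index set $J$ and, for each $i\in J$, a number $\alpha_i\in(0,1]$, an isolated point $\omega_i$ of $\Omega$, and a $w^*$-$w$ point of continuity $x_i^*\in X_1^*$ such that the points $\omega_i$ are pairwise distinct, $\sum_{i\in J}\alpha_i=1$, and $$\Lambda=\sum_{i\in J}\alpha_i\,\delta_{\omega_i}\otimes x_i^*,$$ where the series converges in the norm of $C(\Omega,X)^*$. -/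

import Mathlib

/-- `x` is a `w*`-`w` point of continuity of the closed unit ball of the dual of `E`: it lies in that
ball, and the identity map of the ball, from the (relative) weak-star topology to the (relative)
weak topology of the Banach space `StrongDual 𝕜 E`, is continuous at `x`. -/
def IsWeakStarWeakPC (𝕜 : Type*) {E : Type*} [RCLike 𝕜] [NormedAddCommGroup E] [NormedSpace 𝕜 E]
    (x : StrongDual 𝕜 E) : Prop :=
  ‖x‖ ≤ 1 ∧
    ContinuousWithinAt
      (fun φ : WeakDual 𝕜 E => toWeakSpace 𝕜 (StrongDual 𝕜 E) (WeakDual.toStrongDual φ))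
      {φ : WeakDual 𝕜 E | ‖WeakDual.toStrongDual φ‖ ≤ 1}
      (StrongDual.toWeakDual x)

/-- The functional `δ_ω ⊗ x*` on `C(Ω, X)`, that is, `f ↦ x* (f ω)`. -/
noncomputable def diracTensor {𝕜 Ω X : Type*} [RCLike 𝕜] [TopologicalSpace Ω] [CompactSpace Ω]
    [NormedAddCommGroup X] [NormedSpace 𝕜 X] (ω : Ω) (x : StrongDual 𝕜 X) :
    StrongDual 𝕜 C(Ω, X) :=
  x.comp (ContinuousMap.evalCLM 𝕜 ω)

open Filter Topology

/-! ### Points of continuity, annihilators and separation in a dual space -/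

section Dual

variable {𝕜 E : Type*} [RCLike 𝕜] [NormedAddCommGroup E] [NormedSpace 𝕜 E]

/-! An element of the bidual vanishing on the weak-star dense part of the ball that lies in a
norm-closed subspace must vanish at every point of continuity, so that point lies in the subspace
(`IsWeakStarWeakPC.mem_of_mem_closure`). Apply this to the isometric image of `ℓ¹(Ω, X*)`: its ball
is dense by Hahn-Banach, because point evaluations already compute the sup norm, so `Λ = ∑ δ_ω ⊗ μ
ω`. If `ω₀` is not isolated, its complement is dense, and the same argument for functionals without
an atom at `ω₀` gives `μ ω₀ = 0`.

Normalizing the atoms gives weights of total mass `‖μ‖ ≤ 1`; the missing mass is added at one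
isolated point. Varying one atom while fixing the others maps the ball of `X*` into the large ball,
which passes continuity on to each component. -/

/-- A point is a `w*`-`w` point of continuity of the dual ball iff every element of the bidual is
weak-star continuous at it, relative to the ball. -/
theorem isWeakStarWeakPC_iff {x : StrongDual 𝕜 E} :
    IsWeakStarWeakPC 𝕜 x ↔ ‖x‖ ≤ 1 ∧ ∀ F : StrongDual 𝕜 (StrongDual 𝕜 E),
      ContinuousWithinAt (fun φ : WeakDual 𝕜 E => F (WeakDual.toStrongDual φ))
        {φ : WeakDual 𝕜 E | ‖WeakDual.toStrongDual φ‖ ≤ 1} (StrongDual.toWeakDual x) := by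
  refine and_congr_right fun _ => ?_
  have hind : IsInducing fun (y : WeakSpace 𝕜 (StrongDual 𝕜 E))
      (F : StrongDual 𝕜 (StrongDual 𝕜 E)) => F ((toWeakSpace 𝕜 (StrongDual 𝕜 E)).symm y) := ⟨rfl⟩
  unfold ContinuousWithinAt
  rw [hind.tendsto_nhds_iff, tendsto_pi_nhds]
  rfl

/-- If `x` is a point of continuity in the weak-star closure of a subset of the ball on which an
element of the bidual is constant, then that element takes the same value at `x`. -/
theorem IsWeakStarWeakPC.eq_of_mem_closure {x : StrongDual 𝕜 E} (hx : IsWeakStarWeakPC 𝕜 x)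
    {A : Set (WeakDual 𝕜 E)} (hA : ∀ φ ∈ A, ‖WeakDual.toStrongDual φ‖ ≤ 1)
    (hxA : StrongDual.toWeakDual x ∈ closure A) (F : StrongDual 𝕜 (StrongDual 𝕜 E)) {c : 𝕜}
    (hF : ∀ φ ∈ A, F (WeakDual.toStrongDual φ) = c) : F x = c := by
  have h := ((isWeakStarWeakPC_iff.1 hx).2 F).mono (s := A) hA
  have : NeBot (𝓝[A] (StrongDual.toWeakDual x)) := mem_closure_iff_nhdsWithin_neBot.1 hxA
  refine tendsto_nhds_unique (h : Tendsto _ _ _) (tendsto_const_nhds.congr' ?_)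
  filter_upwards [self_mem_nhdsWithin] with φ hφ using (hF φ hφ).symm

/-- A point outside a closed subspace is separated from it by a functional vanishing on it. -/
theorem Submodule.exists_strongDual_eq_zero_of_notMem {V : Submodule 𝕜 E}
    (hV : IsClosed (V : Set E)) {x : E} (hx : x ∉ V) :
    ∃ F : StrongDual 𝕜 E, (∀ y ∈ V, F y = 0) ∧ F x ≠ 0 := by
  have hx' : ‖(Submodule.Quotient.mk x : E ⧸ V)‖ ≠ 0 := by
    intro h
    have : IsClosed (V.toAddSubgroup : Set E) := hV
    exact hx ((QuotientAddGroup.norm_mk_eq_zero (S := V.toAddSubgroup)).1 h)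
  obtain ⟨g, -, hg⟩ := exists_dual_vector 𝕜 (Submodule.Quotient.mk x : E ⧸ V) hx'
  refine ⟨g.comp V.mkQL, fun y hy => ?_, ?_⟩
  · have : V.mkQL y = 0 := (Submodule.Quotient.mk_eq_zero V).2 hy
    simp [this]
  · change g (Submodule.Quotient.mk x) ≠ 0
    rw [hg]
    exact_mod_cast hx'

theorem IsWeakStarWeakPC.mem_of_mem_closure {x : StrongDual 𝕜 E} (hx : IsWeakStarWeakPC 𝕜 x)
    {V : Submodule 𝕜 (StrongDual 𝕜 E)} (hV : IsClosed (V : Set (StrongDual 𝕜 E)))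
    (hxV : StrongDual.toWeakDual x ∈ closure {φ : WeakDual 𝕜 E |
      WeakDual.toStrongDual φ ∈ V ∧ ‖WeakDual.toStrongDual φ‖ ≤ 1}) : x ∈ V := by
  by_contra h
  obtain ⟨F, hF, hFx⟩ := Submodule.exists_strongDual_eq_zero_of_notMem hV h
  exact hFx (hx.eq_of_mem_closure (fun φ hφ => hφ.2) hxV F fun φ hφ => hF _ hφ.1)

instance WeakDual.isScalarTower_real : IsScalarTower ℝ 𝕜 (WeakDual 𝕜 E) :=
  ⟨fun r c φ => DFunLike.ext _ _ fun g => smul_assoc r c (φ g)⟩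

instance WeakDual.locallyConvexSpace : LocallyConvexSpace ℝ (WeakDual 𝕜 E) :=
  inferInstanceAs (LocallyConvexSpace ℝ (WeakBilin (topDualPairing 𝕜 E)))

/-- A point outside the closure of a convex set is strictly separated from it; convexity is phrased
through the scalar field `𝕜`. -/
theorem RCLike.exists_re_lt_of_notMem_closure {F : Type*} [AddCommGroup F] [TopologicalSpace F]
    [Module 𝕜 F] [Module ℝ F] [IsScalarTower ℝ 𝕜 F] [IsTopologicalAddGroup F] [ContinuousSMul 𝕜 F]
    [LocallyConvexSpace ℝ F] {K : Set F} {x : F}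
    (hK : ∀ φ ∈ K, ∀ ψ ∈ K, ∀ a b : ℝ, 0 ≤ a → 0 ≤ b → a + b = 1 →
      (a : 𝕜) • φ + (b : 𝕜) • ψ ∈ K) (hx : x ∉ closure K) :
    ∃ (f : StrongDual 𝕜 F) (u : ℝ), (∀ φ ∈ K, RCLike.re (f φ) < u) ∧ u < RCLike.re (f x) := by
  have : ContinuousSMul ℝ F := IsScalarTower.continuousSMul 𝕜
  have hK' : Convex ℝ K := fun φ hφ ψ hψ a b ha hb hab => by
    rw [← algebraMap_smul 𝕜 a φ, ← algebraMap_smul 𝕜 b ψ]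
    exact hK φ hφ ψ hψ a b ha hb hab
  obtain ⟨f, u, hf, hu⟩ :=
    RCLike.geometric_hahn_banach_closed_point (𝕜 := 𝕜) hK'.closure isClosed_closure hx
  exact ⟨f, u, fun φ hφ => hf φ (subset_closure hφ), hu⟩

/-- A point outside the weak-star closure of a convex set is strictly separated from it by an
element of the predual. -/
theorem WeakDual.exists_re_lt_of_notMem_closure {K : Set (WeakDual 𝕜 E)} {x : WeakDual 𝕜 E}
    (hK : ∀ φ ∈ K, ∀ ψ ∈ K, ∀ a b : ℝ, 0 ≤ a → 0 ≤ b → a + b = 1 →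
      (a : 𝕜) • φ + (b : 𝕜) • ψ ∈ K) (hx : x ∉ closure K) :
    ∃ (g : E) (u : ℝ), (∀ φ ∈ K, RCLike.re (φ g) < u) ∧ u < RCLike.re (x g) := by
  obtain ⟨f, u, hf, hu⟩ := RCLike.exists_re_lt_of_notMem_closure hK hx
  obtain ⟨g, rfl⟩ := LinearMap.dualEmbedding_surjective (topDualPairing 𝕜 E) f
  exact ⟨g, u, hf, hu⟩

theorem StrongDual.exists_norm_le_one_lt_re (v : StrongDual 𝕜 E) {ε : ℝ} (hε : 0 < ε) :
    ∃ y : E, ‖y‖ ≤ 1 ∧ ‖v‖ - ε < RCLike.re (v y) := by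
  obtain ⟨y, hy, hvy⟩ := v.exists_lt_apply_of_lt_opNorm (sub_lt_self ‖v‖ hε)
  obtain ⟨c, hc, hcv⟩ := RCLike.exists_norm_eq_mul_self (v y)
  refine ⟨c • y, by rw [norm_smul, hc, one_mul]; exact hy.le, ?_⟩
  rwa [map_smul, smul_eq_mul, ← hcv, RCLike.ofReal_re]

end Dual

theorem lp.hasSum_norm_one {ι : Type*} {E : ι → Type*} [∀ i, NormedAddCommGroup (E i)]
    (μ : lp E 1) : HasSum (fun i => ‖μ i‖) ‖μ‖ := by
  simpa using lp.hasSum_norm (by simp) μ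

/-! ### Interpolation by continuous functions of norm at most one -/

section Interpolation

variable {Ω X : Type*} [TopologicalSpace Ω] [CompactSpace Ω] [T2Space Ω]
  [NormedAddCommGroup X] [NormedSpace ℝ X]

theorem exists_continuousMap_eq_on_finset (F : Finset Ω) (y : Ω → X)
    (hy : ∀ ω, ‖y ω‖ ≤ 1) :
    ∃ f : C(Ω, X), ‖f‖ ≤ 1 ∧ ∀ ω ∈ F, f ω = y ω := by
  classical
  have hbump : ∀ ω : Ω, ∃ h : C(Ω, ℝ), h ω = 1 ∧ ∀ ω' ∈ F, ω' ≠ ω → h ω' = 0 := by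
    intro ω
    obtain ⟨h, h0, h1, -⟩ := exists_continuous_zero_one_of_isClosed
      (s := (↑(F.erase ω) : Set Ω)) (t := {ω}) (F.erase ω).finite_toSet.isClosed
      isClosed_singleton (by simp)
    exact ⟨h, h1 rfl, fun ω' hω' hne => h0 (by simp [hω', hne])⟩
  choose h h1 h0 using hbump
  let g : Ω → X := fun t => ∑ ω ∈ F, h ω t • y ω
  have hg : Continuous g := by fun_prop
  have hpos : ∀ t, 0 < max 1 ‖g t‖ := fun t => lt_max_of_lt_left one_pos
  -- Radial retraction onto the unit ball; it fixes the prescribed values, which already lie there.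
  refine ⟨⟨fun t => (max 1 ‖g t‖)⁻¹ • g t,
    ((continuous_const.max hg.norm).inv₀ fun t => (hpos t).ne').smul hg⟩, ?_, ?_⟩
  · refine (ContinuousMap.norm_le _ zero_le_one).2 fun t => ?_
    change ‖(max 1 ‖g t‖)⁻¹ • g t‖ ≤ 1
    rw [norm_smul, norm_inv, Real.norm_of_nonneg (hpos t).le]
    exact inv_mul_le_one_of_le₀ (le_max_right _ _) (hpos t).le
  · intro ω hω
    have hgω : g ω = y ω := by
      change ∑ ω' ∈ F, h ω' ω • y ω' = y ω
      rw [Finset.sum_eq_single ω, h1, one_smul]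
      · intro ω' _ hne
        rw [h0 ω' ω hω hne.symm, zero_smul]
      · exact fun hn => absurd hω hn
    change (max 1 ‖g ω‖)⁻¹ • g ω = y ω
    rw [hgω, max_eq_left (hy ω), inv_one, one_smul]

end Interpolation

/-! ### Atomic functionals on `C(Ω, X)` -/

section ContinuousFunctions

variable {𝕜 Ω X : Type*} [RCLike 𝕜] [TopologicalSpace Ω] [CompactSpace Ω]
  [NormedAddCommGroup X] [NormedSpace 𝕜 X]

@[simp]
theorem diracTensor_apply (ω : Ω) (x : StrongDual 𝕜 X) (f : C(Ω, X)) :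
    diracTensor ω x f = x (f ω) := rfl

theorem diracTensor_smul (ω : Ω) (c : 𝕜) (x : StrongDual 𝕜 X) :
    diracTensor ω (c • x) = c • diracTensor ω x := rfl

theorem norm_diracTensor_le (ω : Ω) (x : StrongDual 𝕜 X) : ‖diracTensor ω x‖ ≤ ‖x‖ :=
  ContinuousLinearMap.opNorm_le_bound _ (norm_nonneg _) fun f =>
    (x.le_opNorm _).trans (mul_le_mul_of_nonneg_left (f.norm_coe_le_norm ω) (norm_nonneg _))

/-- If a subspace of `C(Ω, X)*` contains all `δ_ω ⊗ x*` with `ω` in a dense set, then its unit ball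
is weak-star dense in the unit ball. -/
theorem mem_closure_of_diracTensor_mem {D : Set Ω} (hD : Dense D)
    {V : Submodule 𝕜 (StrongDual 𝕜 C(Ω, X))}
    (hV : ∀ ω ∈ D, ∀ x : StrongDual 𝕜 X, diracTensor ω x ∈ V)
    {Λ : StrongDual 𝕜 C(Ω, X)} (hΛ : ‖Λ‖ ≤ 1) :
    StrongDual.toWeakDual Λ ∈ closure {φ : WeakDual 𝕜 C(Ω, X) |
      WeakDual.toStrongDual φ ∈ V ∧ ‖WeakDual.toStrongDual φ‖ ≤ 1} := by
  set K : Set (WeakDual 𝕜 C(Ω, X)) := {φ | WeakDual.toStrongDual φ ∈ V ∧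
    ‖WeakDual.toStrongDual φ‖ ≤ 1}
  have hKc : ∀ φ ∈ K, ∀ ψ ∈ K, ∀ a b : ℝ, 0 ≤ a → 0 ≤ b → a + b = 1 →
      (a : 𝕜) • φ + (b : 𝕜) • ψ ∈ K := by
    intro φ hφ ψ hψ a b ha hb hab
    have key : WeakDual.toStrongDual ((a : 𝕜) • φ + (b : 𝕜) • ψ) =
        (a : 𝕜) • WeakDual.toStrongDual φ + (b : 𝕜) • WeakDual.toStrongDual ψ := rfl
    refine ⟨key ▸ V.add_mem (V.smul_mem _ hφ.1) (V.smul_mem _ hψ.1), ?_⟩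
    rw [key]
    refine (norm_add_le _ _).trans ?_
    rw [norm_smul, norm_smul, RCLike.norm_of_nonneg ha, RCLike.norm_of_nonneg hb]
    nlinarith [hφ.2, hψ.2]
  by_contra hn
  obtain ⟨g, u, hf', hu'⟩ := WeakDual.exists_re_lt_of_notMem_closure hKc hn
  replace hf' : ∀ φ ∈ K, RCLike.re (WeakDual.toStrongDual φ g) < u := hf'
  replace hu' : u < RCLike.re (Λ g) := hu'
  have hu0 : 0 ≤ u := by
    have h := hf' 0 ⟨by simp, by simp⟩
    simpa using h.le
  have hD' : ∀ ω ∈ D, ‖g ω‖ ≤ u := by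
    intro ω hω
    obtain ⟨x, hx, hxg⟩ := exists_dual_vector'' 𝕜 (g ω)
    have h := hf' (StrongDual.toWeakDual (diracTensor ω x))
      ⟨hV ω hω x, (norm_diracTensor_le ω x).trans hx⟩
    rw [StrongDual.toStrongDual_toWeakDual, diracTensor_apply, hxg, RCLike.ofReal_re] at h
    exact h.le
  have hg : ‖g‖ ≤ u := (ContinuousMap.norm_le g hu0).2 fun ω =>
    (isClosed_le g.continuous.norm continuous_const).closure_subset_iff.2 hD' (hD ω)
  have h1 : RCLike.re (Λ g) ≤ 1 * ‖g‖ :=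
    (RCLike.re_le_norm _).trans (Λ.le_of_opNorm_le hΛ g)
  linarith

theorem continuous_toWeakDual_diracTensor (x : StrongDual 𝕜 X) :
    Continuous fun ω : Ω => StrongDual.toWeakDual (diracTensor ω x) :=
  WeakDual.continuous_of_continuous_eval fun f => x.continuous.comp f.continuous

/-- If replacing a component of a point of continuity never leaves the ball, that component is a
point of continuity as well. -/
theorem IsWeakStarWeakPC.of_add_smul_diracTensor {Φ : StrongDual 𝕜 C(Ω, X)} {a : ℝ} (ha : 0 < a)
    (hΦ : ‖Φ‖ + a ≤ 1) {ω : Ω} {x : StrongDual 𝕜 X} (hx : ‖x‖ ≤ 1)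
    (h : IsWeakStarWeakPC 𝕜 (Φ + (a : 𝕜) • diracTensor ω x)) : IsWeakStarWeakPC 𝕜 x := by
  refine isWeakStarWeakPC_iff.2 ⟨hx, fun G => ?_⟩
  let T : WeakDual 𝕜 X → WeakDual 𝕜 C(Ω, X) := fun ψ =>
    StrongDual.toWeakDual (Φ + (a : 𝕜) • diracTensor ω (WeakDual.toStrongDual ψ))
  have hT : Continuous T := WeakDual.continuous_of_continuous_eval fun f =>
    continuous_const.add ((WeakDual.eval_continuous (f ω)).const_smul (a : 𝕜))
  have hTball : Set.MapsTo T {ψ | ‖WeakDual.toStrongDual ψ‖ ≤ 1}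
      {φ | ‖WeakDual.toStrongDual φ‖ ≤ 1} := by
    intro ψ hψ
    change ‖Φ + (a : 𝕜) • diracTensor ω (WeakDual.toStrongDual ψ)‖ ≤ 1
    refine (norm_add_le _ _).trans (le_trans ?_ hΦ)
    rw [norm_smul, RCLike.norm_of_nonneg ha.le]
    have := (norm_diracTensor_le ω (WeakDual.toStrongDual ψ)).trans hψ
    nlinarith
  -- Restriction to constant functions is a left inverse of `diracTensor ω`, so `G` is recovered
  -- from `G.comp R`.
  let R : StrongDual 𝕜 C(Ω, X) →L[𝕜] StrongDual 𝕜 X :=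
    ContinuousLinearMap.precomp 𝕜 (ContinuousLinearMap.const 𝕜 Ω : X →L[𝕜] C(Ω, X))
  have hR : ∀ y : StrongDual 𝕜 X, R (diracTensor ω y) = y := fun _ => rfl
  have hcont := ((isWeakStarWeakPC_iff.1 h).2 (G.comp R)).comp (f := T)
    (x := StrongDual.toWeakDual x) hT.continuousWithinAt hTball
  have hG : ∀ ψ : WeakDual 𝕜 X, G (WeakDual.toStrongDual ψ) =
      (a : 𝕜)⁻¹ • (G (R (WeakDual.toStrongDual (T ψ))) - G (R Φ)) := by
    intro ψ
    have hTψ : WeakDual.toStrongDual (T ψ) =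
      Φ + (a : 𝕜) • diracTensor ω (WeakDual.toStrongDual ψ) := rfl
    rw [hTψ, map_add, map_add, map_smul, map_smul, hR, add_sub_cancel_left, smul_smul,
      inv_mul_cancel₀ (by exact_mod_cast ha.ne'), one_smul]
  simp only [hG]
  exact (hcont.sub continuousWithinAt_const).const_smul (a : 𝕜)⁻¹

theorem summable_diracTensor (μ : lp (fun _ : Ω => StrongDual 𝕜 X) 1) :
    Summable fun ω => diracTensor ω (μ ω) :=
  .of_norm_bounded (lp.hasSum_norm_one μ).summable fun _ => norm_diracTensor_le _ _

variable [T2Space Ω]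

/-- One function of norm at most one interpolates almost norming vectors for all `v ω` at once. -/
theorem sum_norm_le_norm_sum_diracTensor (F : Finset Ω) (v : Ω → StrongDual 𝕜 X) :
    ∑ ω ∈ F, ‖v ω‖ ≤ ‖∑ ω ∈ F, diracTensor ω (v ω)‖ := by
  let _ : NormedSpace ℝ X := NormedSpace.restrictScalars ℝ 𝕜 X
  refine le_of_forall_pos_le_add fun ε hε => ?_
  have hδ : 0 < ε / (F.card + 1) := by positivity
  choose y hy hvy using fun ω => StrongDual.exists_norm_le_one_lt_re (v ω) hδ
  obtain ⟨f, hf, hfy⟩ := exists_continuousMap_eq_on_finset F y hy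
  have h1 : ∑ ω ∈ F, (‖v ω‖ - ε / (F.card + 1)) ≤
      RCLike.re ((∑ ω ∈ F, diracTensor ω (v ω)) f) := by
    rw [sum_apply, map_sum]
    refine Finset.sum_le_sum fun ω hω => ?_
    rw [diracTensor_apply, hfy ω hω]
    exact (hvy ω).le
  have h2 : RCLike.re ((∑ ω ∈ F, diracTensor ω (v ω)) f) ≤ ‖∑ ω ∈ F, diracTensor ω (v ω)‖ :=
    (RCLike.re_le_norm _).trans (ContinuousLinearMap.unit_le_opNorm _ _ hf)
  have h3 : (F.card : ℝ) * (ε / (F.card + 1)) ≤ ε := by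
    rw [mul_div_assoc', div_le_iff₀ (by positivity)]
    nlinarith
  rw [Finset.sum_sub_distrib, Finset.sum_const, nsmul_eq_mul] at h1
  linarith

variable (𝕜 Ω X) in
/-- The isometric embedding `μ ↦ ∑ ω, δ_ω ⊗ μ ω` of `ℓ¹(Ω, X*)` into `C(Ω, X)*`. -/
noncomputable def atomicFunctional :
    lp (fun _ : Ω => StrongDual 𝕜 X) 1 →ₗᵢ[𝕜] StrongDual 𝕜 C(Ω, X) where
  toFun μ := ∑' ω, diracTensor ω (μ ω)
  map_add' μ ν := by
    rw [← (summable_diracTensor μ).tsum_add (summable_diracTensor ν)]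
    rfl
  map_smul' c μ := by
    rw [RingHom.id_apply, ← (summable_diracTensor μ).tsum_const_smul]
    rfl
  norm_map' μ := by
    refine le_antisymm (tsum_of_norm_bounded (lp.hasSum_norm_one μ)
      fun _ => norm_diracTensor_le _ _) ?_
    exact le_of_tendsto_of_tendsto' (lp.hasSum_norm_one μ)
      (summable_diracTensor μ).hasSum.norm fun F => sum_norm_le_norm_sum_diracTensor F _

theorem hasSum_atomicFunctional (μ : lp (fun _ : Ω => StrongDual 𝕜 X) 1) :
    HasSum (fun ω => diracTensor ω (μ ω)) (atomicFunctional 𝕜 Ω X μ) :=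
  (summable_diracTensor μ).hasSum

theorem atomicFunctional_single [DecidableEq Ω] (ω : Ω) (x : StrongDual 𝕜 X) :
    atomicFunctional 𝕜 Ω X (lp.single 1 ω x) = diracTensor ω x := by
  refine (hasSum_atomicFunctional _).unique ?_
  convert hasSum_single ω ?_ using 1
  · rw [lp.single_apply_self]
  · intro ω' h
    rw [lp.single_apply_ne _ _ _ h]
    rfl

theorem isClosed_map_atomicFunctional {W : Submodule 𝕜 (lp (fun _ : Ω => StrongDual 𝕜 X) 1)}
    (hW : IsClosed (W : Set (lp (fun _ : Ω => StrongDual 𝕜 X) 1))) :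
    IsClosed (W.map (atomicFunctional 𝕜 Ω X).toLinearMap : Set (StrongDual 𝕜 C(Ω, X))) :=
  (atomicFunctional 𝕜 Ω X).isometry.isClosedEmbedding.isClosedMap _ hW

variable (𝕜 X) in
/-- The functionals `∑ ω, δ_ω ⊗ μ ω` without an atom at `ω₀`. -/
noncomputable def atomicFunctionalVanishing (ω₀ : Ω) : Submodule 𝕜 (StrongDual 𝕜 C(Ω, X)) :=
  (LinearMap.ker (lp.evalCLM 𝕜 (fun _ : Ω => StrongDual 𝕜 X) (p := 1) ω₀).toLinearMap).map
    (atomicFunctional 𝕜 Ω X).toLinearMap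

theorem isClosed_atomicFunctionalVanishing (ω₀ : Ω) :
    IsClosed (atomicFunctionalVanishing 𝕜 X ω₀ : Set (StrongDual 𝕜 C(Ω, X))) :=
  isClosed_map_atomicFunctional
    (lp.evalCLM 𝕜 (fun _ : Ω => StrongDual 𝕜 X) (p := 1) ω₀).isClosed_ker

theorem atomicFunctional_mem_vanishing_iff {ω₀ : Ω}
    {μ : lp (fun _ : Ω => StrongDual 𝕜 X) 1} :
    atomicFunctional 𝕜 Ω X μ ∈ atomicFunctionalVanishing 𝕜 X ω₀ ↔ μ ω₀ = 0 := by
  constructor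
  · rintro ⟨ν, hν, h⟩
    rw [← (atomicFunctional 𝕜 Ω X).injective h]
    exact hν
  · exact fun h => ⟨μ, h, rfl⟩

theorem diracTensor_mem_atomicFunctionalVanishing_iff {ω ω₀ : Ω} {x : StrongDual 𝕜 X} :
    diracTensor ω x ∈ atomicFunctionalVanishing 𝕜 X ω₀ ↔ ω ≠ ω₀ ∨ x = 0 := by
  classical
  rw [← atomicFunctional_single, atomicFunctional_mem_vanishing_iff, lp.single_apply]
  rcases eq_or_ne ω ω₀ with rfl | h
  · simp
  · simp [h]

/-- A point of continuity of the dual ball of `C(Ω, X)` is carried by isolated points. -/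
theorem IsWeakStarWeakPC.exists_atomicFunctional_eq {Λ : StrongDual 𝕜 C(Ω, X)}
    (hΛ : IsWeakStarWeakPC 𝕜 Λ) :
    ∃ μ, atomicFunctional 𝕜 Ω X μ = Λ ∧ ∀ ω, μ ω ≠ 0 → IsOpen {ω} := by
  classical
  let V := (⊤ : Submodule 𝕜 (lp (fun _ : Ω => StrongDual 𝕜 X) 1)).map
    (atomicFunctional 𝕜 Ω X).toLinearMap
  have hV : ∀ ω (x : StrongDual 𝕜 X), diracTensor ω x ∈ V := fun ω x =>
    Submodule.mem_map.2 ⟨lp.single 1 ω x, Submodule.mem_top, atomicFunctional_single ω x⟩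
  obtain ⟨μ, -, hμ⟩ := Submodule.mem_map.1 (hΛ.mem_of_mem_closure (V := V)
    (isClosed_map_atomicFunctional isClosed_univ)
    (mem_closure_of_diracTensor_mem dense_univ (fun ω _ => hV ω) hΛ.1))
  refine ⟨μ, hμ, fun ω hω => ?_⟩
  by_contra h
  have hmem := hΛ.mem_of_mem_closure (isClosed_atomicFunctionalVanishing ω)
    (mem_closure_of_diracTensor_mem (dense_compl_singleton_iff_not_open.2 h)
      (fun ω' hω' x => diracTensor_mem_atomicFunctionalVanishing_iff.2 (.inl hω')) hΛ.1)
  rw [← hμ] at hmem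
  exact hω (atomicFunctional_mem_vanishing_iff.1 hmem)

/-- Needed when `Λ = 0`, where no atom supplies an isolated point to carry the unit mass. -/
theorem exists_isOpen_singleton_of_isWeakStarWeakPC_zero [Nonempty Ω] [Nontrivial X]
    (h : IsWeakStarWeakPC 𝕜 (0 : StrongDual 𝕜 C(Ω, X))) : ∃ ω : Ω, IsOpen {ω} := by
  let ω₀ : Ω := Classical.arbitrary Ω
  refine ⟨ω₀, ?_⟩
  by_contra hω₀
  obtain ⟨x, hx, -⟩ := exists_dual_vector' 𝕜 (0 : X)
  have hx0 : x ≠ 0 := by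
    rintro rfl
    simp at hx
  have hmem : diracTensor ω₀ x ∉ atomicFunctionalVanishing 𝕜 X ω₀ := by
    simp [diracTensor_mem_atomicFunctionalVanishing_iff, hx0]
  obtain ⟨F, hF, hFx⟩ := Submodule.exists_strongDual_eq_zero_of_notMem
    (isClosed_atomicFunctionalVanishing ω₀) hmem
  -- These tend weak-star to `0` as `ω → ω₀`, while `F` keeps a constant nonzero value on them for
  -- `ω ≠ ω₀`. The factor `2⁻¹` keeps them in the ball.
  let g : Ω → WeakDual 𝕜 C(Ω, X) := fun ω =>
    (2⁻¹ : 𝕜) • (StrongDual.toWeakDual (diracTensor ω₀ x) -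
      StrongDual.toWeakDual (diracTensor ω x))
  have hg : Continuous g :=
    Continuous.const_smul (continuous_const.sub (continuous_toWeakDual_diracTensor x)) (2⁻¹ : 𝕜)
  have hg' : ∀ ω, WeakDual.toStrongDual (g ω) =
    (2⁻¹ : 𝕜) • (diracTensor ω₀ x - diracTensor ω x) := fun _ => rfl
  have hcl : StrongDual.toWeakDual (0 : StrongDual 𝕜 C(Ω, X)) ∈ closure (g '' {ω₀}ᶜ) := by
    have h0 : g ω₀ = StrongDual.toWeakDual (0 : StrongDual 𝕜 C(Ω, X)) := by simp [g]
    rw [← h0]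
    exact image_closure_subset_closure_image hg
      ⟨ω₀, dense_compl_singleton_iff_not_open.2 hω₀ ω₀, rfl⟩
  have key := h.eq_of_mem_closure (c := (2⁻¹ : 𝕜) * F (diracTensor ω₀ x)) ?_ hcl F ?_
  · rw [map_zero] at key
    exact mul_ne_zero (by norm_num) hFx key.symm
  · rintro _ ⟨ω, -, rfl⟩
    rw [hg', norm_smul, norm_inv, RCLike.norm_ofNat]
    have h1 := norm_sub_le (diracTensor ω₀ x) (diracTensor ω x)
    have h2 := norm_diracTensor_le ω₀ x
    have h3 := norm_diracTensor_le ω x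
    linarith
  · rintro _ ⟨ω, hω, rfl⟩
    rw [hg', map_smul, map_sub,
      hF _ (diracTensor_mem_atomicFunctionalVanishing_iff.2 (.inl hω)), sub_zero, smul_eq_mul]

end ContinuousFunctions

/-! ### The representation -/

theorem theorem3p3 {𝕜 Ω X : Type*} [RCLike 𝕜]
    [TopologicalSpace Ω] [CompactSpace Ω] [T2Space Ω] [Nonempty Ω]
    [NormedAddCommGroup X] [NormedSpace 𝕜 X] [CompleteSpace X] [Nontrivial X]
    (Λ : StrongDual 𝕜 C(Ω, X)) (hΛ : IsWeakStarWeakPC 𝕜 Λ) :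
    ∃ (ι : Type) (_ : Countable ι) (α : ι → ℝ) (ω : ι → Ω) (x : ι → StrongDual 𝕜 X),
      (∀ i, α i ∈ Set.Ioc (0 : ℝ) 1) ∧
      HasSum α 1 ∧
      Function.Injective ω ∧
      (∀ i, IsOpen ({ω i} : Set Ω)) ∧
      (∀ i, IsWeakStarWeakPC 𝕜 (x i)) ∧
      HasSum (fun i => (α i : 𝕜) • diracTensor (ω i) (x i)) Λ := by
  classical
  obtain ⟨μ, hμ, hiso⟩ := hΛ.exists_atomicFunctional_eq
  have hnorm : ‖μ‖ ≤ 1 := by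
    rw [← (atomicFunctional 𝕜 Ω X).norm_map μ, hμ]
    exact hΛ.1
  obtain ⟨ω₀, hω₀⟩ : ∃ ω : Ω, IsOpen {ω} := by
    by_cases h : ∃ ω, μ ω ≠ 0
    · exact h.imp hiso
    · push Not at h
      have hμ0 : μ = 0 := lp.ext (funext h)
      rw [hμ0, map_zero] at hμ
      exact exists_isOpen_singleton_of_isWeakStarWeakPC_zero (hμ ▸ hΛ)
  -- The missing mass, placed at `ω₀`, makes the weights `a` sum to `1`.
  let s : Ω → ℝ := Pi.single ω₀ (1 - ‖μ‖)
  have hs : HasSum s (1 - ‖μ‖) := hasSum_pi_single _ _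
  have hs0 : ∀ ω, 0 ≤ s ω := fun ω =>
    (Pi.single_nonneg.2 (sub_nonneg.2 hnorm) : (0 : Ω → ℝ) ≤ s) ω
  have hs1 : ∀ ω, s ω ≤ 1 - ‖μ‖ := fun ω => le_hasSum hs ω fun ω' _ => hs0 ω'
  let a : Ω → ℝ := fun ω => ‖μ ω‖ + s ω
  have ha0 : ∀ ω, 0 ≤ a ω := fun ω => add_nonneg (norm_nonneg _) (hs0 ω)
  have ha : HasSum a 1 := by simpa using (lp.hasSum_norm_one μ).add hs
  have ha1 : ∀ ω, a ω ≤ 1 := fun ω => le_hasSum ha ω fun ω' _ => ha0 ω'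
  let S : Set Ω := Function.support a
  have hS : Countable S := ha.summable.countable_support.to_subtype
  have hpos : ∀ ω ∈ S, 0 < a ω := fun ω hω => (ha0 ω).lt_of_ne' hω
  have hzero : ∀ ω, a ω = 0 → μ ω = 0 := by
    intro ω h
    rw [← norm_eq_zero]
    have := hs0 ω
    have := norm_nonneg (μ ω)
    simp only [a] at h
    linarith
  have hsmul : ∀ ω, (a ω : 𝕜) • ((a ω : 𝕜)⁻¹ • μ ω) = μ ω := by
    intro ω
    rcases eq_or_ne (a ω) 0 with h | h
    · rw [hzero ω h]
      have h0 : ∀ c : 𝕜, c • (0 : StrongDual 𝕜 X) = 0 := fun c =>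
        ContinuousLinearMap.ext fun _ => mul_zero c
      exact (congrArg _ (h0 _)).trans (h0 _)
    · exact smul_inv_smul₀ (by exact_mod_cast h) _
  -- A countable set is small, so the index type can be taken in `Type`.
  let e : Shrink.{0} S ≃ S := (equivShrink.{0} S).symm
  refine ⟨Shrink.{0} S, e.countable_iff.2 hS, fun i => a (e i), fun i => e i,
    fun i => (a (e i) : 𝕜)⁻¹ • μ (e i), fun i => ⟨hpos _ (e i).2, ha1 _⟩, ?_,
    Subtype.val_injective.comp e.injective, fun i => ?_, fun i => ?_, ?_⟩
  · exact (e.hasSum_iff (f := fun ω : S => a ω)).2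
      ((hasSum_subtype_iff_of_support_subset subset_rfl).2 ha)
  -- Without an atom of `μ`, the weight comes from `s`, so the point is `ω₀`.
  · by_cases h : μ (e i) = 0
    · by_cases h' : (e i : Ω) = ω₀
      · beta_reduce
        rwa [h']
      · exact absurd (show a (e i) = 0 by simp [a, s, h, Pi.single_eq_of_ne h']) (e i).2
    · exact hiso _ h
  · have hai := hpos _ (e i).2
    beta_reduce
    generalize (e i : Ω) = ω at hai ⊢
    -- `Φ` is `Λ` without its atom at `ω`; its norm is `‖μ‖ - ‖μ ω‖`, and `s ω ≤ 1 - ‖μ‖` leaves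
    -- room for weight `a ω`.
    refine IsWeakStarWeakPC.of_add_smul_diracTensor (ω := ω)
      (Φ := atomicFunctional 𝕜 Ω X (μ - lp.single 1 ω (μ ω))) hai ?_ ?_ ?_
    · have h := lp.norm_compl_sum_single (p := 1) (by simp) μ {ω}
      simp only [ENNReal.toReal_one, Real.rpow_one, Finset.sum_singleton] at h
      rw [(atomicFunctional 𝕜 Ω X).norm_map, h]
      have := hs1 ω
      simp only [a]
      linarith
    · rw [norm_smul, norm_inv, RCLike.norm_of_nonneg hai.le]
      exact inv_mul_le_one_of_le₀ (le_add_of_nonneg_right (hs0 ω)) hai.le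
    · rw [← diracTensor_smul, hsmul, map_sub, atomicFunctional_single, sub_add_cancel, hμ]
      exact hΛ
  · simp only [← diracTensor_smul, hsmul]
    have hsupp : Function.support (fun ω => diracTensor ω (μ ω)) ⊆ S := by
      intro ω hω h0
      exact hω (congrArg (diracTensor ω) (hzero ω h0))
    exact (e.hasSum_iff (f := fun ω : S => diracTensor (ω : Ω) (μ ω))).2
      ((hasSum_subtype_iff_of_support_subset hsupp).2 (hμ ▸ hasSum_atomicFunctional μ))
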